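/- Let $\Gamma=(V,E,w)$ be a directed network: a directed graph with vertex set $V$ and edge set $E$ (loops, multiple edges and infinite $V,E$ are allowed) whose edge weights $w(e)$, $e\in E$, are independent formal variables. Let $V$ be arbitrarily partitioned into a boundary $\partial\Gamma$ and an interior $V\setminus\partial\Gamma$. The weight $w(\pi)$ of a walk $\pi$ is the product of the weights of its edges. Call a walk $a=v_0\to v_1\to\cdots\to v_m=b$ with $b\in\partial\Gamma$ admissible if $m>0$ and $v_1,\dots,v_{m-1}\notin\partial\Gamma$. The hitting matrix is $X=(X(a,b))_{a\in V,\,b\in\partial\Gamma}$, where $X(a,b)=\sum_\pi w(\pi)$, a formal power series in the edge weights, is the sum over all admissible walks $\pi$ from $a$ to $b$. The loop-erased part $\mathrm{LE}(\pi)$ of a walk $\pi$ is obtained as follows: as long as the walk $v_0\to\cdots\to v_m$ has a repeated vertex, find $v_i=v_j$ with $i<j$ and the smallest value of $j$, and remove the segment $v_i\to\cdots\to v_j$. For an admissible walk $\pi$, let $\mathrm{LE}^\ast(\pi)$ be the loop-erased part of $\pi$ computed with the endpoint of $\pi$ regarded as different from its starting point even if the two coincide; that is, $\mathrm{LE}^\ast(\pi)$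 is the loop-erased part of $\pi$ without its last step, followed by that last step. Theorem. Let $a_1,\dots,a_k$ be distinct elements of $V$ and let $b_1,\dots,b_k$ be distinct elements of $\partial\Gamma$. Then all the sums here are well-defined formal power series, and $$\det\bigl(X(a_i,b_j)\bigr)_{i,j=1}^k=\sum_{\sigma\in S_k}\operatorname{sgn}(\sigma)\sum_{(\pi_1,\dots,\pi_k)}w(\pi_1)\cdots w(\pi_k),$$ where the inner sum is over all families of walks such that (1) each $\pi_i$ is an admissible walk from $a_i$ to $b_{\sigma(i)}$, i.e. it has nonzero length and its internal vertices are all in the interior; (2) for any $1\le i<j\le k$, the walks $\pi_j$ and $\mathrm{LE}^\ast(\pi_i)$ have no common vertices in the interior of $\Gamma$. If moreover $\{a_1,\dots,a_k\}\cap\{b_1,\dots,b_k\}=\emptyset$, then the formula also holds with $\mathrm{LE}(\pi_i)$ in place of $\mathrm{LE}^\ast(\pi_i)$ in (2). -/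

import Mathlib

open scoped MvPowerSeries.WithPiTopology

/-- A directed graph with vertex set `V` and edge set `E`; loops and multiple edges are allowed,
and no finiteness is imposed. The weight of the edge `e` is the formal variable
`MvPowerSeries.X e`. -/
structure DirectedNetwork (V E : Type*) where
  /-- the vertex at which an edge starts -/
  src : E → V
  /-- the vertex at which an edge ends -/
  tgt : E → V

namespace DirectedNetwork

variable {V E : Type*} (Γ : DirectedNetwork V E)

/-- The edges in the list form a walk from the first to the second vertex. -/
def IsWalk : V → List E → V → Prop
  | a, [], b => a = b
  | a, e :: es, b => Γ.src e = a ∧ IsWalk (Γ.tgt e) es b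

/-- The vertices `a₀ = a, a₁, …, aₘ` through which a walk from `a` with edges `es` passes. -/
def vertices (a : V) (es : List E) : List V := a :: es.map Γ.tgt

/-- The `j`-th vertex of the walk is equal to an earlier one. -/
def RepeatsAt (a : V) (es : List E) (j : ℕ) : Prop :=
  j ≤ es.length ∧ ∃ i, i < j ∧ (Γ.vertices a es)[i]? = (Γ.vertices a es)[j]?

open Classical in
/-- Loop erasure, on edge sequences of walks from `a`. As long as the walk has a
self-intersection, find `aᵢ = aⱼ` with `i < j` and the smallest value of `j`, and remove the
segment `aᵢ → ⋯ → aⱼ` (the edges `e_{i+1}, …, e_j`). -/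
noncomputable def loopErase (a : V) (es : List E) : List E :=
  if h : ∃ j, Γ.RepeatsAt a es j then
    loopErase a (es.take (Nat.find (Nat.find_spec h).2) ++ es.drop (Nat.find h))
  else es
termination_by es.length
decreasing_by
  have h1 := (Nat.find_spec h).1
  have h2 := (Nat.find_spec (Nat.find_spec h).2).1
  simp only [List.length_append, List.length_take, List.length_drop]
  omega

variable {Γ}

theorem IsWalk.append {a c b : V} {es fs : List E} (h : Γ.IsWalk a es c) (h' : Γ.IsWalk c fs b) :
    Γ.IsWalk a (es ++ fs) b := by
  induction es generalizing a with
  | nil => cases h; exact h'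
  | cons e es ih => exact ⟨h.1, ih h.2⟩

theorem IsWalk.exists_split {a b : V} {es : List E} (h : Γ.IsWalk a es b) {n : ℕ}
    (hn : n ≤ es.length) :
    ∃ c, (Γ.vertices a es)[n]? = some c ∧ Γ.IsWalk a (es.take n) c ∧ Γ.IsWalk c (es.drop n) b := by
  induction es generalizing a n with
  | nil =>
    obtain rfl : n = 0 := by simpa using hn
    exact ⟨a, rfl, rfl, h⟩
  | cons e es ih =>
    cases n with
    | zero => exact ⟨a, rfl, rfl, h⟩
    | succ n =>
      obtain ⟨c, h1, h2, h3⟩ := ih h.2 (n := n) (by simpa using hn)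
      exact ⟨c, by simpa [vertices] using h1, ⟨h.1, h2⟩, h3⟩

theorem IsWalk.loopErase {a b : V} {es : List E} (h : Γ.IsWalk a es b) :
    Γ.IsWalk a (Γ.loopErase a es) b := by
  classical
  induction hn : es.length using Nat.strong_induction_on generalizing es with
  | _ n ih =>
    rw [DirectedNetwork.loopErase]
    split_ifs with hr
    · have h1 := (Nat.find_spec hr).1
      obtain ⟨h2, h3⟩ := Nat.find_spec (Nat.find_spec hr).2
      refine ih _ ?_ ?_ rfl
      · simp only [List.length_append, List.length_take, List.length_drop]
        omega
      · obtain ⟨c, c1, c2, -⟩ := h.exists_split (h2.le.trans h1)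
        obtain ⟨d, d1, -, d3⟩ := h.exists_split h1
        obtain rfl : c = d := by
          rw [c1, d1] at h3
          exact Option.some.inj h3
        exact c2.append d3
    · exact h

variable (Γ)

/-- Walks from `a` to `b`. -/
@[ext] structure Walk (a b : V) where
  /-- the edge sequence -/
  edges : List E
  isWalk : Γ.IsWalk a edges b

namespace Walk

variable {Γ} {a b : V}

/-- The sequence of vertices `a₀ = a, a₁, …, aₘ = b` of a walk. -/
def vertices (π : Γ.Walk a b) : List V := Γ.vertices a π.edges

/-- The weight of a walk: the product of the formal variables of its edges. -/
noncomputable def weight (R : Type*) [CommRing R] (π : Γ.Walk a b) : MvPowerSeries E R :=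
  (π.edges.map fun e => MvPowerSeries.X e).prod

/-- A walk of nonzero length all of whose internal vertices (`a₁, …, a_{m-1}`) lie outside the
boundary. -/
def IsHitting (bd : Set V) (π : Γ.Walk a b) : Prop :=
  π.edges ≠ [] ∧ ∀ v ∈ (π.edges.map Γ.tgt).dropLast, v ∉ bd

/-- The loop-erased part `LE(π)`. -/
noncomputable def LE (π : Γ.Walk a b) : Γ.Walk a b :=
  ⟨Γ.loopErase a π.edges, π.isWalk.loopErase⟩

/-- The loop-erased part of `π` computed with the endpoint of `π` regarded as different from all
the vertices visited before (even if it is equal to the starting vertex): the loops of `π` without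
its last step are erased, and the last step is appended. -/
noncomputable def endLE (π : Γ.Walk a b) : Γ.Walk a b where
  edges := Γ.loopErase a (π.edges.take (π.edges.length - 1)) ++
    π.edges.drop (π.edges.length - 1)
  isWalk := by
    obtain ⟨c, -, h1, h2⟩ := π.isWalk.exists_split (Nat.sub_le π.edges.length 1)
    exact h1.loopErase.append h2

end Walk

/-- The hitting matrix for the boundary `bd`: its entry at `a ∈ V`, `b ∈ bd` is the formal power
series in the edge weights which is the sum of the weights of all walks from `a` to `b` of nonzero
length whose internal vertices all lie in the interior. -/
noncomputable def hittingMatrix (R : Type*) [CommRing R] [TopologicalSpace R] (bd : Set V) :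
    Matrix V bd (MvPowerSeries E R) :=
  Matrix.of fun a b => ∑' π : {π : Γ.Walk a b // π.IsHitting bd}, π.1.weight R

/-- Families of walks `πᵢ : aᵢ → b_{σ(i)}` of nonzero length with internal vertices in the interior
such that, for `i < j`, the walks `πⱼ` and `LE(πᵢ)` have no common vertex in the interior. -/
def LEFamily (bd : Set V) {k : ℕ} (a : Fin k → V) (b : Fin k → bd) (σ : Equiv.Perm (Fin k)) :
    Set (∀ i, Γ.Walk (a i) (b (σ i))) :=
  {π | (∀ i, (π i).IsHitting bd) ∧
    ∀ i j, i < j → ∀ v ∉ bd, ¬ (v ∈ (π j).vertices ∧ v ∈ (π i).LE.vertices)}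

/-- The same, with the end of each walk `πᵢ` regarded as different from its starting point when
loops are erased. -/
def EndLEFamily (bd : Set V) {k : ℕ} (a : Fin k → V) (b : Fin k → bd) (σ : Equiv.Perm (Fin k)) :
    Set (∀ i, Γ.Walk (a i) (b (σ i))) :=
  {π | (∀ i, (π i).IsHitting bd) ∧
    ∀ i j, i < j → ∀ v ∉ bd, ¬ (v ∈ (π j).vertices ∧ v ∈ (π i).endLE.vertices)}

end DirectedNetwork

namespace DirectedNetwork

/-! ### Loop erasure: one-step recursion, initial parts, last visits -/

section LoopErasure

/-! The determinant expands into a signed sum over all families of admissible walks. The families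
violating (2) cancel under a sign-reversing exchange of tails, as in the Lindström–Gessel–Viennot
argument.

In a violating family take the least `i` whose loop-erased walk meets a later walk in the interior,
the first such vertex `v` along that erasure, and the least `j > i` whose walk passes through `v`.
Cut both walks at their last visits to `v`, `p i = q ++ r` and `p j = q' ++ r'`, and exchange `r`
and `r'`. This multiplies `σ` by a transposition and keeps the multiset of edges.

The exchange is an involution because the same `i`, `v`, `j` are found again. The erasure of `q`
ends at `v`. The tail `r` avoids it in the interior, since a return would have cut `v` off
(`IsWalk.not_mem_loopErase_of_mem`); `r'` avoids it because `v` is the first intersection and is not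
visited again. So the erasure of `q` is an initial part of the erasure of either walk without its
last step (`exists_loopErase_append`). The structure `IsSwitch` lists conditions symmetric in the
two tails: `IsSwitch.symm` and `IsSwitch.unique` give the involution, `sum_sign_eq_zero` the
cancellation. Since only finitely many families have a given edge multiset, everything is done
coefficient by coefficient. -/

theorem eq_of_append_cons_eq_append_cons {α : Type*} {x : α} {l l' r r' : List α} (hr : x ∉ r)
    (hr' : x ∉ r') (h : l ++ x :: r = l' ++ x :: r') : r = r' := by
  rcases List.append_eq_append_iff.1 h with ⟨c, -, hc⟩ | ⟨c, -, hc⟩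
  all_goals
    rcases c with _ | ⟨y, c⟩
    · simpa [eq_comm] using hc
    · obtain ⟨-, rfl⟩ := List.cons.inj hc
      simp at hr hr'

variable {V E : Type*} (Γ : DirectedNetwork V E)

theorem vertices_append (a : V) (p q : List E) :
    Γ.vertices a (p ++ q) = Γ.vertices a p ++ q.map Γ.tgt := by
  simp [vertices]

theorem length_vertices (a : V) (p : List E) : (Γ.vertices a p).length = p.length + 1 := by
  simp [vertices]

theorem vertices_take (a : V) (p : List E) (n : ℕ) :
    Γ.vertices a (p.take n) = (Γ.vertices a p).take (n + 1) := by
  simp [vertices, List.map_take]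

theorem exists_repeatsAt_iff (a : V) (p : List E) :
    (∃ j, Γ.RepeatsAt a p j) ↔ ¬ (Γ.vertices a p).Nodup := by
  rw [List.nodup_iff_getElem?_ne_getElem?]
  push Not
  constructor
  · rintro ⟨j, hj, i, hij, h⟩
    exact ⟨i, j, hij, by rw [length_vertices]; omega, h⟩
  · rintro ⟨i, j, hij, hj, h⟩
    rw [length_vertices] at hj
    exact ⟨j, by omega, i, hij, h⟩

theorem repeatsAt_append {a : V} {p : List E} (q : List E) {j : ℕ} (hj : j ≤ p.length) :
    Γ.RepeatsAt a (p ++ q) j ↔ Γ.RepeatsAt a p j := by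
  have key (i : ℕ) (hi : i ≤ p.length) :
      (Γ.vertices a (p ++ q))[i]? = (Γ.vertices a p)[i]? := by
    rw [vertices_append, List.getElem?_append_left]
    rw [length_vertices]
    omega
  constructor
  · rintro ⟨-, i, hij, h⟩
    rw [key i (by omega), key j hj] at h
    exact ⟨hj, i, hij, h⟩
  · rintro ⟨-, i, hij, h⟩
    rw [← key i (by omega), ← key j hj] at h
    exact ⟨by simp; omega, i, hij, h⟩

theorem loopErase_of_nodup {a : V} {p : List E} (h : (Γ.vertices a p).Nodup) :
    Γ.loopErase a p = p := by
  rw [loopErase, dif_neg]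
  rw [exists_repeatsAt_iff]
  exact not_not.2 h

/-- The definition picks the least `i`, but there is no choice: two candidates would form a
repetition before `j`. -/
theorem loopErase_of_first_repeat {a : V} {p : List E} {i j : ℕ} (hj : j ≤ p.length) (hij : i < j)
    (h : (Γ.vertices a p)[i]? = (Γ.vertices a p)[j]?) (hmin : ∀ l < j, ¬ Γ.RepeatsAt a p l) :
    Γ.loopErase a p = Γ.loopErase a (p.take i ++ p.drop j) := by
  classical
  have hex : ∃ j, Γ.RepeatsAt a p j := ⟨j, hj, i, hij, h⟩
  have hfind : Nat.find hex = j := (Nat.find_eq_iff hex).2 ⟨⟨hj, i, hij, h⟩, hmin⟩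
  rw [loopErase, dif_pos hex]
  have hfind' : Nat.find (Nat.find_spec hex).2 = i := by
    obtain ⟨h1, h2⟩ := Nat.find_spec (Nat.find_spec hex).2
    generalize Nat.find (Nat.find_spec hex).2 = i' at h1 h2 ⊢
    rw [hfind] at h1 h2
    by_contra hne
    rcases lt_or_gt_of_ne hne with hlt | hlt
    · exact hmin i hij ⟨by omega, i', hlt, h2.trans h.symm⟩
    · exact hmin i' h1 ⟨by omega, i, hlt, h.trans h2.symm⟩
  rw [hfind', hfind]

theorem nodup_vertices_loopErase (a : V) (p : List E) :
    (Γ.vertices a (Γ.loopErase a p)).Nodup := by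
  classical
  induction hn : p.length using Nat.strong_induction_on generalizing p with
  | _ n ih =>
    by_cases hr : ∃ j, Γ.RepeatsAt a p j
    · obtain ⟨h1, i, h2, h3⟩ := Nat.find_spec hr
      rw [Γ.loopErase_of_first_repeat h1 h2 h3 fun l hl => Nat.find_min hr hl]
      refine ih _ ?_ _ rfl
      simp only [List.length_append, List.length_take, List.length_drop]
      omega
    · rw [exists_repeatsAt_iff, not_not] at hr
      rwa [Γ.loopErase_of_nodup hr]

/-- Loops are erased in the order in which they close, so those of `p` go before `e` matters; then
`e` either extends the erased path or closes a single loop on it. This gives a recursion on the last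
edge, on which the later arguments rest. -/
theorem loopErase_concat (a : V) (p : List E) (e : E) :
    (Γ.tgt e ∉ Γ.vertices a (Γ.loopErase a p) →
      Γ.loopErase a (p ++ [e]) = Γ.loopErase a p ++ [e]) ∧
    ∀ i, (Γ.vertices a (Γ.loopErase a p))[i]? = some (Γ.tgt e) →
      Γ.loopErase a (p ++ [e]) = (Γ.loopErase a p).take i := by
  classical
  induction hn : p.length using Nat.strong_induction_on generalizing p with
  | _ n ih =>
    by_cases hr : ∃ j, Γ.RepeatsAt a p j
    · obtain ⟨h1, i, h2, h3⟩ := Nat.find_spec hr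
      have hmin : ∀ l < Nat.find hr, ¬ Γ.RepeatsAt a p l := fun l hl => Nat.find_min hr hl
      generalize Nat.find hr = j at *
      have hlen : (p.take i ++ p.drop j).length < n := by
        simp only [List.length_append, List.length_take, List.length_drop]
        omega
      -- The first repetition of `p` is also the first one of `p ++ [e]`.
      have hcat : Γ.loopErase a (p ++ [e]) = Γ.loopErase a ((p.take i ++ p.drop j) ++ [e]) := by
        rw [Γ.loopErase_of_first_repeat (p := p ++ [e]) (i := i) (j := j) (by simp; omega) h2]
        · rw [List.take_append_of_le_length (by omega), List.drop_append_of_le_length h1,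
            List.append_assoc]
        · rw [vertices_append, List.getElem?_append_left (by rw [length_vertices]; omega),
            List.getElem?_append_left (by rw [length_vertices]; omega), h3]
        · intro l hl
          rw [Γ.repeatsAt_append _ (by omega)]
          exact hmin l hl
      rw [hcat, Γ.loopErase_of_first_repeat h1 h2 h3 hmin]
      exact ih _ hlen _ rfl
    · have hnd := hr
      rw [exists_repeatsAt_iff, not_not] at hnd
      rw [Γ.loopErase_of_nodup hnd]
      constructor
      · intro he
        refine Γ.loopErase_of_nodup ?_
        rw [vertices_append]
        exact hnd.append (by simp) (by simpa using he)
      · intro i hi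
        obtain ⟨hi', -⟩ := List.getElem?_eq_some_iff.1 hi
        have hi'' := hi'
        rw [length_vertices] at hi'
        -- Index `p.length + 1` is the endpoint of `e`, the only vertex that can be a repetition
        -- here.
        rw [Γ.loopErase_of_first_repeat (i := i) (j := p.length + 1) (by simp) (by omega),
          List.drop_of_length_le (by simp), List.append_nil,
          List.take_append_of_le_length (by omega), Γ.loopErase_of_nodup]
        · rw [vertices_take]
          exact hnd.sublist (List.take_sublist _ _)
        · rw [vertices_append, List.getElem?_append_left hi'', hi,
            List.getElem?_append_right (by rw [length_vertices])]
          simp [length_vertices]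
        · intro l hl
          rw [Γ.repeatsAt_append _ (by omega)]
          exact fun h => hr ⟨l, h⟩

theorem loopErase_concat_of_mem {a : V} {p : List E} {e : E}
    (h : Γ.tgt e ∈ Γ.vertices a (Γ.loopErase a p)) :
    ∃ i, (Γ.vertices a (Γ.loopErase a p))[i]? = some (Γ.tgt e) ∧
      Γ.loopErase a (p ++ [e]) = (Γ.loopErase a p).take i := by
  obtain ⟨i, hi⟩ := List.getElem?_of_mem h
  exact ⟨i, hi, (Γ.loopErase_concat a p e).2 i hi⟩

theorem mem_vertices_loopErase_concat {a x : V} {p : List E} {e : E}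
    (h : x ∈ Γ.vertices a (Γ.loopErase a (p ++ [e]))) :
    x ∈ Γ.vertices a (Γ.loopErase a p) ∨ x = Γ.tgt e := by
  by_cases he : Γ.tgt e ∈ Γ.vertices a (Γ.loopErase a p)
  · obtain ⟨i, -, hi⟩ := Γ.loopErase_concat_of_mem he
    rw [hi, vertices_take] at h
    exact Or.inl (List.mem_of_mem_take h)
  · rw [(Γ.loopErase_concat a p e).1 he, vertices_append] at h
    simpa using h

theorem vertices_loopErase_subset (a : V) (p : List E) :
    Γ.vertices a (Γ.loopErase a p) ⊆ Γ.vertices a p := by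
  induction p using List.reverseRecOn with
  | nil => rw [Γ.loopErase_of_nodup (by simp [vertices])]; exact List.Subset.refl _
  | append_singleton p e ih =>
    intro x hx
    rw [vertices_append]
    rcases Γ.mem_vertices_loopErase_concat hx with h | rfl
    · exact List.mem_append_left _ (ih h)
    · simp

/-- If a walk does not return to its loop-erased part, then the latter is an initial part of the
loop erasure of the whole walk. -/
theorem exists_loopErase_append {a : V} (p q : List E)
    (h : ∀ x ∈ q.map Γ.tgt, x ∉ Γ.vertices a (Γ.loopErase a p)) :
    ∃ r, Γ.loopErase a (p ++ q) = Γ.loopErase a p ++ r := by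
  induction q using List.reverseRecOn with
  | nil => exact ⟨[], by simp⟩
  | append_singleton q e ih =>
    obtain ⟨r, hr⟩ := ih fun x hx => h x (by rw [List.map_append]; exact List.mem_append_left _ hx)
    have he := h (Γ.tgt e) (by simp)
    rw [← List.append_assoc]
    by_cases hmem : Γ.tgt e ∈ Γ.vertices a (Γ.loopErase a (p ++ q))
    · obtain ⟨i, hi, hcat⟩ := Γ.loopErase_concat_of_mem hmem
      rw [hcat, hr]
      refine ⟨r.take (i - (Γ.loopErase a p).length), ?_⟩
      have hlen : (Γ.loopErase a p).length ≤ i := by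
        by_contra hlt
        rw [hr, vertices_append, List.getElem?_append_left (by rw [length_vertices]; omega)] at hi
        exact he (List.mem_of_getElem? hi)
      rw [List.take_append, List.take_of_length_le hlen]
    · exact ⟨r ++ [e], by rw [(Γ.loopErase_concat a _ e).1 hmem, hr, List.append_assoc]⟩

variable {Γ}

theorem IsWalk.exists_vertices_eq_concat {a v : V} {p : List E} (h : Γ.IsWalk a p v) :
    ∃ u, Γ.vertices a p = u ++ [v] := by
  induction p generalizing a with
  | nil => cases h; exact ⟨[], rfl⟩
  | cons e p ih =>
    obtain ⟨u, hu⟩ := ih h.2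
    exact ⟨a :: u, by rw [List.cons_append, ← hu]; rfl⟩

theorem IsWalk.end_mem_vertices {a v : V} {p : List E} (h : Γ.IsWalk a p v) :
    v ∈ Γ.vertices a p := by
  obtain ⟨u, hu⟩ := h.exists_vertices_eq_concat
  simp [hu]

theorem IsWalk.end_unique {a v w : V} {p : List E} (h : Γ.IsWalk a p v) (h' : Γ.IsWalk a p w) :
    v = w := by
  obtain ⟨u, hu⟩ := h.exists_vertices_eq_concat
  obtain ⟨u', hu'⟩ := h'.exists_vertices_eq_concat
  rw [hu] at hu'
  simpa using (List.append_inj' hu' rfl).2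

theorem IsWalk.of_append {a v b : V} {p q : List E} (h : Γ.IsWalk a p v)
    (h' : Γ.IsWalk a (p ++ q) b) : Γ.IsWalk v q b := by
  induction p generalizing a with
  | nil => cases h; exact h'
  | cons e p ih => exact ih h.2 h'.2

/-- If a vertex of the loop-erased part is visited last at the end of `p`, then the rest of the
walk does not meet the loop-erased part of `p`. -/
theorem IsWalk.not_mem_loopErase_of_mem {a v : V} {p : List E} (hp : Γ.IsWalk a p v)
    (q : List E) (hv : v ∉ q.map Γ.tgt) (hmem : v ∈ Γ.vertices a (Γ.loopErase a (p ++ q))) :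
    ∀ x ∈ q.map Γ.tgt, x ∉ Γ.vertices a (Γ.loopErase a p) := by
  induction q using List.reverseRecOn with
  | nil => simp
  | append_singleton q e ih =>
    have hvq : v ∉ q.map Γ.tgt := fun h => hv (by rw [List.map_append]; exact List.mem_append_left _ h)
    have hve : v ≠ Γ.tgt e := fun h => hv (by simp [h])
    rw [← List.append_assoc] at hmem
    have ih := ih hvq ((Γ.mem_vertices_loopErase_concat hmem).resolve_right hve)
    intro x hx
    rw [List.map_append, List.mem_append] at hx
    rcases hx with hx | hx
    · exact ih x hx
    · obtain rfl : x = Γ.tgt e := by simpa using hx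
      intro hxp
      obtain ⟨r, hr⟩ := Γ.exists_loopErase_append p q ih
      obtain ⟨u, hu⟩ := hp.loopErase.exists_vertices_eq_concat
      have hnd := Γ.nodup_vertices_loopErase a p
      rw [hu] at hxp hnd
      have hxu : Γ.tgt e ∈ u := by
        rcases List.mem_append.1 hxp with h | h
        · exact h
        · exact absurd (by simpa using h) hve.symm
      obtain ⟨i, hi⟩ := List.getElem?_of_mem hxu
      obtain ⟨hiu, -⟩ := List.getElem?_eq_some_iff.1 hi
      -- The return is to a vertex of `u`, strictly before `v` on the erased path, so closing this
      -- loop removes `v`, against `hmem`.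
      have hcat := (Γ.loopErase_concat a (p ++ q) e).2 i (by
        rw [hr, vertices_append, hu, List.append_assoc, List.getElem?_append_left hiu, hi])
      rw [hcat, vertices_take, hr, vertices_append, hu, List.append_assoc,
        List.take_append_of_le_length (by omega)] at hmem
      exact (List.disjoint_of_nodup_append hnd) (List.mem_of_mem_take hmem) (by simp)

theorem IsWalk.exists_last_visit {a b x : V} {p : List E} (h : Γ.IsWalk a p b)
    (hx : x ∈ Γ.vertices a p) :
    ∃ q r, p = q ++ r ∧ Γ.IsWalk a q x ∧ Γ.IsWalk x r b ∧ x ∉ r.map Γ.tgt := by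
  induction p generalizing a with
  | nil =>
    obtain rfl : x = a := by simpa [vertices] using hx
    exact ⟨[], [], rfl, rfl, h, by simp⟩
  | cons e p ih =>
    by_cases hxp : x ∈ Γ.vertices (Γ.tgt e) p
    · obtain ⟨q, r, rfl, h1, h2, h3⟩ := ih h.2 hxp
      exact ⟨e :: q, r, rfl, ⟨h.1, h1⟩, h2, h3⟩
    · obtain rfl : x = a := by
        simp only [vertices, List.map_cons, List.mem_cons] at hx hxp
        tauto
      exact ⟨[], e :: p, rfl, rfl, h, by simpa [vertices] using hxp⟩

/-- The decomposition at the last visit to a vertex is unique. -/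
theorem IsWalk.last_visit_unique {a v : V} {p q p' q' : List E} (hp : Γ.IsWalk a p v)
    (hp' : Γ.IsWalk a p' v) (hq : v ∉ q.map Γ.tgt) (hq' : v ∉ q'.map Γ.tgt)
    (h : p ++ q = p' ++ q') : p = p' ∧ q = q' := by
  obtain ⟨u, hu⟩ := hp.exists_vertices_eq_concat
  obtain ⟨u', hu'⟩ := hp'.exists_vertices_eq_concat
  have key : q.length = q'.length := by
    have h1 := congrArg (Γ.vertices a) h
    rw [vertices_append, vertices_append, hu, hu', List.append_assoc, List.append_assoc] at h1
    simpa using congrArg List.length (eq_of_append_cons_eq_append_cons hq hq' h1)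
  exact List.append_inj' h key

end LoopErasure

end DirectedNetwork

namespace DirectedNetwork

/-! ### The sign-reversing exchange of tails -/

section Switching

variable {V E : Type*} (Γ : DirectedNetwork V E) (bd : Set V)

/-- The edges in the list form a walk of nonzero length from `a` to `b` whose internal vertices
lie outside the boundary. -/
def IsHit (a : V) (p : List E) (b : V) : Prop :=
  Γ.IsWalk a p b ∧ p ≠ [] ∧ ∀ v ∈ (p.map Γ.tgt).dropLast, v ∉ bd

variable {k : ℕ} (a : Fin k → V)

/-- A later walk meets the loop-erased part of the `i`-th one in the interior. -/
def MeetsAt (p : Fin k → List E) (i : Fin k) : Prop :=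
  ∃ j, i < j ∧ ∃ v ∉ bd, v ∈ Γ.vertices (a j) (p j) ∧
    v ∈ Γ.vertices (a i) (Γ.loopErase (a i) (p i).dropLast)

/-- The place at which the tails of two walks of a family are exchanged: `i` is the first index
such that the loop-erased part of the `i`-th walk meets a later walk in the interior, `v` is the
first such vertex on the loop-erased part, `j` is the first index of a later walk through `v`, and
`p i = q ++ r`, `p j = q' ++ r'` are the decompositions at the last visits to `v`. -/
structure IsSwitch (p : Fin k → List E) (i j : Fin k) (v : V) (q r q' r' : List E) : Prop where
  lt : i < j
  interior : v ∉ bd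
  eq_left : p i = q ++ r
  eq_right : p j = q' ++ r'
  walk_left : Γ.IsWalk (a i) q v
  walk_right : Γ.IsWalk (a j) q' v
  last_left : v ∉ r.map Γ.tgt
  last_right : v ∉ r'.map Γ.tgt
  avoid_left : ∀ x ∈ r.map Γ.tgt, x ∉ bd → x ∉ Γ.vertices (a i) (Γ.loopErase (a i) q)
  avoid_right : ∀ x ∈ r'.map Γ.tgt, x ∉ bd → x ∉ Γ.vertices (a i) (Γ.loopErase (a i) q)
  avoid_head : ∀ x ∈ Γ.vertices (a j) q', x ∉ bd → x ≠ v →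
    x ∉ Γ.vertices (a i) (Γ.loopErase (a i) q)
  avoid_other : ∀ l, i < l → l ≠ j → ∀ x ∈ Γ.vertices (a l) (p l), x ∉ bd → x ≠ v →
    x ∉ Γ.vertices (a i) (Γ.loopErase (a i) q)
  first_right : ∀ l, i < l → l < j → v ∉ Γ.vertices (a l) (p l)
  first_left : ∀ l < i, ¬ Γ.MeetsAt bd a p l

variable {Γ bd a}

theorem IsHit.tail_ne_nil {a b v : V} {q r : List E} (h : Γ.IsHit bd a (q ++ r) b) (hb : b ∈ bd)
    (hq : Γ.IsWalk a q v) (hv : v ∉ bd) : r ≠ [] := by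
  rintro rfl
  rw [List.append_nil] at h
  exact hv (hq.end_unique h.1 ▸ hb)

theorem IsHit.tail {a b v : V} {q r : List E} (h : Γ.IsHit bd a (q ++ r) b) (hr : r ≠ [])
    (hq : Γ.IsWalk a q v) : Γ.IsHit bd v r b := by
  refine ⟨hq.of_append h.1, hr, fun x hx => h.2.2 x ?_⟩
  rw [List.map_append, List.dropLast_append_of_ne_nil (by simpa)]
  exact List.mem_append_right _ hx

theorem IsHit.head_interior {a b : V} {q r : List E} (h : Γ.IsHit bd a (q ++ r) b)
    (hr : r ≠ []) : ∀ x ∈ q.map Γ.tgt, x ∉ bd := by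
  intro x hx
  refine h.2.2 x ?_
  rw [List.map_append, List.dropLast_append_of_ne_nil (by simpa)]
  exact List.mem_append_left _ hx

theorem IsHit.prepend {a b v : V} {q r : List E} (h : Γ.IsHit bd v r b)
    (hq : Γ.IsWalk a q v) (hqi : ∀ x ∈ q.map Γ.tgt, x ∉ bd) : Γ.IsHit bd a (q ++ r) b := by
  refine ⟨hq.append h.1, by simp [h.2.1], fun x hx => ?_⟩
  rw [List.map_append, List.dropLast_append_of_ne_nil (by simpa using h.2.1),
    List.mem_append] at hx
  exact hx.elim (hqi x) (h.2.2 x)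

theorem IsHit.dropLast_interior {a b : V} {p : List E} (h : Γ.IsHit bd a p b) :
    ∀ x ∈ p.dropLast.map Γ.tgt, x ∉ bd := by
  intro x hx
  rw [List.map_dropLast] at hx
  exact h.2.2 x hx

theorem mem_vertices_dropLast {a b x : V} {p : List E} (h : Γ.IsHit bd a p b) (hb : b ∈ bd)
    (hx : x ∉ bd) (hmem : x ∈ Γ.vertices a p) : x ∈ Γ.vertices a p.dropLast := by
  obtain ⟨u, hu⟩ := h.1.exists_vertices_eq_concat
  have h1 : Γ.vertices a p.dropLast = (Γ.vertices a p).dropLast := by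
    have : p.map Γ.tgt ≠ [] := by simpa using h.2.1
    simp [vertices, List.map_dropLast, List.dropLast_cons_of_ne_nil this]
  rw [hu] at hmem
  rw [h1, hu, List.dropLast_concat]
  rcases List.mem_append.1 hmem with h | h
  · exact h
  · obtain rfl : x = b := by simpa using h
    exact absurd hb hx

/-- Three successive minimal choices, of `i`, `v` and `j`. The last visit to `v` gives `avoid_left`;
the minimality of `v` along the erased path gives the other avoidance conditions. -/
theorem exists_isSwitch {p : Fin k → List E} {c : Fin k → V} (hc : ∀ i, c i ∈ bd)
    (hp : ∀ i, Γ.IsHit bd (a i) (p i) (c i)) (hmeet : ∃ i, Γ.MeetsAt bd a p i) :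
    ∃ i j v q r q' r', Γ.IsSwitch bd a p i j v q r q' r' := by
  classical
  obtain ⟨i, hi, hmin⟩ : ∃ i, Γ.MeetsAt bd a p i ∧ ∀ l < i, ¬ Γ.MeetsAt bd a p l := by
    obtain ⟨i, hi⟩ := hmeet
    induction i using WellFoundedLT.induction with
    | _ i ih =>
      by_cases h : ∃ l < i, Γ.MeetsAt bd a p l
      · obtain ⟨l, hl, hl'⟩ := h
        exact ih l hl hl'
      · push Not at h
        exact ⟨i, hi, h⟩
  set ρ := (p i).dropLast with hρ
  obtain ⟨v, hv⟩ : ∃ v, (Γ.vertices (a i) (Γ.loopErase (a i) ρ)).find?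
      (fun x => x ∉ bd ∧ ∃ j, i < j ∧ x ∈ Γ.vertices (a j) (p j)) = some v := by
    rw [← Option.isSome_iff_exists, List.find?_isSome]
    obtain ⟨j, hij, v, hv, hvj, hvi⟩ := hi
    exact ⟨v, hvi, by simpa using ⟨hv, j, hij, hvj⟩⟩
  rw [List.find?_eq_some_iff_append] at hv
  obtain ⟨hv, u, w, huw, hu⟩ := hv
  simp only [decide_eq_true_eq] at hv
  obtain ⟨hvbd, hex⟩ := hv
  obtain ⟨j, ⟨hij, hvj⟩, hjmin⟩ : ∃ j, (i < j ∧ v ∈ Γ.vertices (a j) (p j)) ∧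
      ∀ l < j, ¬ (i < l ∧ v ∈ Γ.vertices (a l) (p l)) := by
    obtain ⟨j, hj⟩ := hex
    induction j using WellFoundedLT.induction with
    | _ j ih =>
      by_cases h : ∃ l < j, (i < l ∧ v ∈ Γ.vertices (a l) (p l))
      · obtain ⟨l, hl, hl'⟩ := h
        exact ih l hl hl'
      · push Not at h
        exact ⟨j, hj, fun l hl hl' => h l hl hl'.1 hl'.2⟩
  have hvL : v ∈ Γ.vertices (a i) (Γ.loopErase (a i) ρ) := by simp [huw]
  have hvi : v ∈ Γ.vertices (a i) (p i) := by
    have h1 := Γ.vertices_loopErase_subset (a i) ρ hvL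
    simp only [vertices, hρ, List.map_dropLast, List.mem_cons] at h1 ⊢
    exact h1.imp_right List.mem_of_mem_dropLast
  obtain ⟨q, r, hqr, hq, -, hr⟩ := (hp i).1.exists_last_visit hvi
  obtain ⟨q', r', hqr', hq', -, hr'⟩ := (hp j).1.exists_last_visit hvj
  have hit := hp i
  rw [hqr] at hit
  have hit' := hp j
  rw [hqr'] at hit'
  have hrnil := hit.tail_ne_nil (hc i) hq hvbd
  have hρ' : ρ = q ++ r.dropLast := by rw [hρ, hqr, List.dropLast_append_of_ne_nil hrnil]
  have hav := hq.not_mem_loopErase_of_mem r.dropLast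
    (fun h => hr (by rw [List.map_dropLast] at h; exact List.mem_of_mem_dropLast h)) (hρ' ▸ hvL)
  obtain ⟨s, hs⟩ := Γ.exists_loopErase_append q _ hav
  obtain ⟨u', hu'⟩ := hq.loopErase.exists_vertices_eq_concat
  -- The erasure of `q` is an initial part of that of `ρ` and ends at `v`, which occurs there only
  -- once. So the vertices preceding `v` are the same in both.
  have huu : u = u' := by
    have h1 := huw
    rw [hρ', hs, vertices_append, hu', List.append_assoc, List.singleton_append] at h1
    have hnd := Γ.nodup_vertices_loopErase (a i) ρ
    rw [huw] at hnd
    have hnd' := List.nodup_append.1 hnd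
    refine ((List.append_cons_inj_of_notMem ?_ ?_).1 h1.symm).1
    · exact fun h => hnd'.2.2 v h v (by simp) rfl
    · exact (List.nodup_cons.1 hnd'.2.1).1
  subst huu
  have hfirst : ∀ l, i < l → ∀ x ∈ Γ.vertices (a l) (p l), x ∉ bd → x ≠ v →
      x ∉ Γ.vertices (a i) (Γ.loopErase (a i) q) := by
    intro l hl x hx hxbd hxv hmem
    rw [hu'] at hmem
    have hxu : x ∈ u := by
      rcases List.mem_append.1 hmem with h | h
      · exact h
      · exact absurd (by simpa using h) hxv
    have := hu x hxu
    simp only [Bool.not_eq_true', decide_eq_false_iff_not] at this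
    exact this ⟨hxbd, l, hl, hx⟩
  refine ⟨i, j, v, q, r, q', r', hij, hvbd, hqr, hqr', hq, hq', hr, hr', ?_, ?_, ?_, ?_, ?_, hmin⟩
  · intro x hx hxbd
    -- The last vertex of `r` is in the boundary, so an interior `x` already occurs in `r.dropLast`,
    -- where `hav` applies.
    have h1 := mem_vertices_dropLast (hit.tail hrnil hq) (hc i) hxbd
      (List.mem_cons_of_mem v hx)
    rcases List.mem_cons.1 h1 with rfl | h1
    · exact absurd hx hr
    · exact hav x h1
  · intro x hx hxbd
    refine hfirst j hij x ?_ hxbd (fun h => hr' (h ▸ hx))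
    rw [hqr', vertices_append]
    exact List.mem_append_right _ hx
  · intro x hx hxbd hxv
    refine hfirst j hij x ?_ hxbd hxv
    rw [hqr', vertices_append]
    exact List.mem_append_left _ hx
  · exact fun l hl _ => hfirst l hl
  · exact fun l hl hl' h => hjmin l hl' ⟨hl, h⟩

/-- The family with the tails of two walks exchanged. -/
def switched (p : Fin k → List E) (i j : Fin k) (q r q' r' : List E) : Fin k → List E :=
  Function.update (Function.update p i (q ++ r')) j (q' ++ r)

theorem switched_left {p : Fin k → List E} {i j : Fin k} {q r q' r' : List E} (h : i ≠ j) :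
    switched p i j q r q' r' i = q ++ r' := by
  simp [switched, h]

theorem switched_right {p : Fin k → List E} {i j : Fin k} {q r q' r' : List E} :
    switched p i j q r q' r' j = q' ++ r := by
  simp [switched]

theorem switched_of_ne {p : Fin k → List E} {i j l : Fin k} {q r q' r' : List E} (hi : l ≠ i)
    (hj : l ≠ j) : switched p i j q r q' r' l = p l := by
  simp [switched, hi, hj]

namespace IsSwitch

variable {p : Fin k → List E} {i j : Fin k} {v : V} {q r q' r' : List E}

/-- The heads `q`, `q'` stay, and the avoidance conditions treat `r` and `r'` alike. -/
theorem symm (h : Γ.IsSwitch bd a p i j v q r q' r') :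
    Γ.IsSwitch bd a (switched p i j q r q' r') i j v q r' q' r where
  lt := h.lt
  interior := h.interior
  eq_left := switched_left h.lt.ne
  eq_right := switched_right
  walk_left := h.walk_left
  walk_right := h.walk_right
  last_left := h.last_right
  last_right := h.last_left
  avoid_left := h.avoid_right
  avoid_right := h.avoid_left
  avoid_head := h.avoid_head
  avoid_other l hl hlj := by
    rw [switched_of_ne hl.ne' hlj]
    exact h.avoid_other l hl hlj
  first_right l hl hlj := by
    rw [switched_of_ne hl.ne' hlj.ne]
    exact h.first_right l hl hlj
  first_left l hl := by
    rintro ⟨m, hlm, x, hx, hxm, hxl⟩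
    rw [switched_of_ne hl.ne (hl.trans h.lt).ne] at hxl
    refine h.first_left l hl ?_
    -- Walks before `i` are unchanged, and any vertex on an exchanged walk was already on `p i` or
    -- `p j`; both come after `l`, so no new intersection arises.
    have hi : x ∈ Γ.vertices (a i) (p i) → Γ.MeetsAt bd a p l := fun h => ⟨i, hl, x, hx, h, hxl⟩
    have hj : x ∈ Γ.vertices (a j) (p j) → Γ.MeetsAt bd a p l :=
      fun h' => ⟨j, hl.trans h.lt, x, hx, h', hxl⟩
    rw [h.eq_left, vertices_append, List.mem_append] at hi
    rw [h.eq_right, vertices_append, List.mem_append] at hj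
    by_cases hmi : m = i
    · rw [hmi, switched_left h.lt.ne, vertices_append, List.mem_append] at hxm
      exact hxm.elim (fun h => hi (Or.inl h)) (fun h => hj (Or.inr h))
    · by_cases hmj : m = j
      · rw [hmj, switched_right, vertices_append, List.mem_append] at hxm
        exact hxm.elim (fun h => hj (Or.inl h)) (fun h => hi (Or.inr h))
      · rw [switched_of_ne hmi hmj] at hxm
        exact ⟨m, hlm, x, hx, hxm, hxl⟩

theorem switched_switched (h : Γ.IsSwitch bd a p i j v q r q' r') :
    switched (switched p i j q r q' r') i j q r' q' r = p := by
  funext l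
  by_cases hi : l = i
  · rw [hi, switched_left h.lt.ne, h.eq_left]
  · by_cases hj : l = j
    · rw [hj, switched_right, h.eq_right]
    · rw [switched_of_ne hi hj, switched_of_ne hi hj]

/-- The tail can return to the erased path of `q` only at its final boundary vertex, and `dropLast`
discards that one. -/
theorem exists_loopErase_dropLast (h : Γ.IsSwitch bd a p i j v q r q' r') {c : V} (hc : c ∈ bd)
    (hp : Γ.IsHit bd (a i) (p i) c) :
    ∃ s, Γ.loopErase (a i) (p i).dropLast = Γ.loopErase (a i) q ++ s := by
  rw [h.eq_left] at hp ⊢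
  have hr := hp.tail_ne_nil hc h.walk_left h.interior
  rw [List.dropLast_append_of_ne_nil hr]
  refine Γ.exists_loopErase_append q _ fun x hx => h.avoid_left x ?_ ?_
  · rw [List.map_dropLast] at hx
    exact List.mem_of_mem_dropLast hx
  · exact (hp.tail hr h.walk_left).dropLast_interior x hx

theorem mem_left (h : Γ.IsSwitch bd a p i j v q r q' r') :
    v ∈ Γ.vertices (a i) (Γ.loopErase (a i) q) :=
  h.walk_left.loopErase.end_mem_vertices

theorem mem_right (h : Γ.IsSwitch bd a p i j v q r q' r') : v ∈ Γ.vertices (a j) (p j) := by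
  rw [h.eq_right, vertices_append]
  exact List.mem_append_left _ h.walk_right.end_mem_vertices

theorem avoid (h : Γ.IsSwitch bd a p i j v q r q' r') {l : Fin k} (hl : i < l) {x : V}
    (hx : x ∈ Γ.vertices (a l) (p l)) (hxbd : x ∉ bd) (hxv : x ≠ v) :
    x ∉ Γ.vertices (a i) (Γ.loopErase (a i) q) := by
  by_cases hlj : l = j
  · subst hlj
    rw [h.eq_right, vertices_append, List.mem_append] at hx
    exact hx.elim (fun hx => h.avoid_head x hx hxbd hxv) (fun hx => h.avoid_right x hx hxbd)
  · exact h.avoid_other l hl hlj x hx hxbd hxv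

theorem meetsAt (h : Γ.IsSwitch bd a p i j v q r q' r') {c : V} (hc : c ∈ bd)
    (hp : Γ.IsHit bd (a i) (p i) c) : Γ.MeetsAt bd a p i := by
  obtain ⟨s, hs⟩ := h.exists_loopErase_dropLast hc hp
  refine ⟨j, h.lt, v, h.interior, h.mem_right, ?_⟩
  rw [hs, vertices_append]
  exact List.mem_append_left _ h.mem_left

/-- Both `i` and `i₂` are the first index with an intersection. The erasures of `q` and `q₂` are
then initial parts of one path, so one contains the other; if `v ≠ v₂`, the longer contains a
forbidden intersection before its end. Now `j` is the first later index through `v`, and last visits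
fix the cuts. -/
theorem unique {i₂ j₂ : Fin k} {v₂ : V} {q₂ r₂ q₂' r₂' : List E} {c : Fin k → V}
    (hc : ∀ i, c i ∈ bd) (hp : ∀ i, Γ.IsHit bd (a i) (p i) (c i))
    (h : Γ.IsSwitch bd a p i j v q r q' r') (h₂ : Γ.IsSwitch bd a p i₂ j₂ v₂ q₂ r₂ q₂' r₂') :
    i = i₂ ∧ j = j₂ ∧ q = q₂ ∧ r = r₂ ∧ q' = q₂' ∧ r' = r₂' := by
  obtain rfl : i = i₂ := by
    rcases lt_trichotomy i i₂ with hlt | heq | hlt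
    · exact absurd (h.meetsAt (hc _) (hp _)) (h₂.first_left _ hlt)
    · exact heq
    · exact absurd (h₂.meetsAt (hc _) (hp _)) (h.first_left _ hlt)
  obtain rfl : v = v₂ := by
    obtain ⟨s, hs⟩ := h.exists_loopErase_dropLast (hc _) (hp _)
    obtain ⟨s₂, hs₂⟩ := h₂.exists_loopErase_dropLast (hc _) (hp _)
    by_contra hne
    have h1 := h.avoid h₂.lt h₂.mem_right h₂.interior (Ne.symm hne)
    have h2 := h₂.avoid h.lt h.mem_right h.interior hne
    rw [hs] at hs₂
    rcases List.append_eq_append_iff.1 hs₂ with ⟨t, ht, -⟩ | ⟨t, ht, -⟩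
    · refine h2 ?_
      rw [ht, vertices_append]
      exact List.mem_append_left _ h.mem_left
    · refine h1 ?_
      rw [ht, vertices_append]
      exact List.mem_append_left _ h₂.mem_left
  obtain rfl : j = j₂ := by
    rcases lt_trichotomy j j₂ with hlt | heq | hlt
    · exact absurd h.mem_right (h₂.first_right _ h.lt hlt)
    · exact heq
    · exact absurd h₂.mem_right (h.first_right _ h₂.lt hlt)
  obtain ⟨h1, h2⟩ := h.walk_left.last_visit_unique h₂.walk_left h.last_left h₂.last_left
    (h.eq_left.symm.trans h₂.eq_left)
  obtain ⟨h3, h4⟩ := h.walk_right.last_visit_unique h₂.walk_right h.last_right h₂.last_right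
    (h.eq_right.symm.trans h₂.eq_right)
  exact ⟨rfl, rfl, h1, h2, h3, h4⟩

theorem isHit_switched {b : Fin k → V} {σ : Equiv.Perm (Fin k)} (hb : ∀ i, b i ∈ bd)
    (h : Γ.IsSwitch bd a p i j v q r q' r') (hp : ∀ i, Γ.IsHit bd (a i) (p i) (b (σ i)))
    (l : Fin k) :
    Γ.IsHit bd (a l) (switched p i j q r q' r' l) (b ((σ * Equiv.swap i j) l)) := by
  have hi := hp i
  have hj := hp j
  rw [h.eq_left] at hi
  rw [h.eq_right] at hj
  have hr := hi.tail_ne_nil (hb _) h.walk_left h.interior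
  have hr' := hj.tail_ne_nil (hb _) h.walk_right h.interior
  rw [Equiv.Perm.mul_apply]
  by_cases hli : l = i
  · subst hli
    rw [switched_left h.lt.ne, Equiv.swap_apply_left]
    exact (hj.tail hr' h.walk_right).prepend h.walk_left (hi.head_interior hr)
  · by_cases hlj : l = j
    · subst hlj
      rw [switched_right, Equiv.swap_apply_right]
      exact (hi.tail hr h.walk_left).prepend h.walk_right (hj.head_interior hr')
    · rw [switched_of_ne hli hlj, Equiv.swap_apply_of_ne_of_ne hli hlj]
      exact hp l

theorem sum_switched (h : Γ.IsSwitch bd a p i j v q r q' r') :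
    ∑ l, (switched p i j q r q' r' l : Multiset E) = ∑ l, (p l : Multiset E) := by
  have key (f : Fin k → Multiset E) :
      ∑ l, f l = f i + (f j + ∑ l ∈ (Finset.univ.erase i).erase j, f l) := by
    rw [Finset.add_sum_erase _ _ (by simp [h.lt.ne']), Finset.add_sum_erase _ _ (by simp)]
  rw [key, key, switched_left h.lt.ne, switched_right, h.eq_left, h.eq_right]
  rw [Finset.sum_congr rfl fun l hl => ?_]
  · simp only [← Multiset.coe_add]
    abel
  · simp only [Finset.mem_erase] at hl
    rw [switched_of_ne hl.2.1 hl.1]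

end IsSwitch

/-- The families of walks in which a walk meets an earlier loop-erased part cancel out. -/
theorem sum_sign_eq_zero {b : Fin k → V} (hb : ∀ i, b i ∈ bd) (m : Multiset E)
    (T : Finset (Equiv.Perm (Fin k) × (Fin k → List E)))
    (hT : ∀ t, t ∈ T ↔ (∀ i, Γ.IsHit bd (a i) (t.2 i) (b (t.1 i))) ∧
      (∃ i, Γ.MeetsAt bd a t.2 i) ∧ ∑ i, (t.2 i : Multiset E) = m) :
    ∑ t ∈ T, (Equiv.Perm.sign t.1 : ℤ) = 0 := by
  have key : ∀ t ∈ T, ∃ t' : Equiv.Perm (Fin k) × (Fin k → List E),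
      ∃ i j v q r q' r', Γ.IsSwitch bd a t.2 i j v q r q' r' ∧
        t' = (t.1 * Equiv.swap i j, switched t.2 i j q r q' r') := by
    intro t ht
    obtain ⟨h1, h2, -⟩ := (hT t).1 ht
    obtain ⟨i, j, v, q, r, q', r', h⟩ := exists_isSwitch (fun i => hb (t.1 i)) h1 h2
    exact ⟨_, i, j, v, q, r, q', r', h, rfl⟩
  choose g hg using key
  have hmem : ∀ t ht, g t ht ∈ T := by
    intro t ht
    obtain ⟨h1, h2, h3⟩ := (hT t).1 ht
    obtain ⟨i, j, v, q, r, q', r', h, heq⟩ := hg t ht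
    have hhit := h.isHit_switched hb h1
    rw [hT, heq]
    exact ⟨hhit, ⟨i, h.symm.meetsAt (hb _) (hhit i)⟩, h.sum_switched.trans h3⟩
  have hsign : ∀ t ht, (Equiv.Perm.sign (g t ht).1 : ℤ) = - Equiv.Perm.sign t.1 := by
    intro t ht
    obtain ⟨i, j, v, q, r, q', r', h, heq⟩ := hg t ht
    rw [heq, Equiv.Perm.sign_mul, Equiv.Perm.sign_swap h.lt.ne]
    simp
  refine Finset.sum_involution g (fun t ht => by rw [hsign, add_neg_cancel]) ?_ hmem ?_
  · intro t ht hne heq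
    have := hsign t ht
    rw [heq] at this
    omega
  · intro t ht
    obtain ⟨i, j, v, q, r, q', r', h, heq⟩ := hg t ht
    obtain ⟨i₂, j₂, v₂, q₂, r₂, q₂', r₂', h₂, heq₂⟩ := hg _ (hmem t ht)
    have hhit := ((hT _).1 (hmem t ht)).1
    have hsymm := h.symm
    have hp2 : (g t ht).2 = switched t.2 i j q r q' r' := by rw [heq]
    rw [← hp2] at hsymm
    -- The data chosen for `g t` must be those of the reverse exchange, so applying `g` twice
    -- restores `t`.
    obtain ⟨rfl, rfl, rfl, rfl, rfl, rfl⟩ := hsymm.unique (fun i => hb _) hhit h₂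
    rw [heq₂, hp2, h.switched_switched, heq, mul_assoc, Equiv.swap_mul_self, mul_one]

end Switching

end DirectedNetwork

/-! ### Power series counting objects by exponent -/

section CountingSeries

open MvPowerSeries

variable {E : Type*} (R : Type*) [CommRing R]

/-- The sum of the monomials with exponents `m x`, when each exponent occurs finitely often. -/
noncomputable def countingSeries {ι : Type*} (m : ι → E →₀ ℕ) : MvPowerSeries E R :=
  fun d => (Set.ncard {x | m x = d} : R)

theorem coeff_countingSeries {ι : Type*} (m : ι → E →₀ ℕ) (d : E →₀ ℕ) :
    coeff d (countingSeries R m) = (Set.ncard {x | m x = d} : R) := rfl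

/-- Convergence is coefficientwise, and each coefficient is a finite sum; so any topology on `R`
will do. -/
theorem hasSum_countingSeries [TopologicalSpace R] {ι : Type*} {m : ι → E →₀ ℕ}
    (hm : ∀ d, {x | m x = d}.Finite) :
    HasSum (fun x => monomial (m x) (1 : R)) (countingSeries R m) := by
  classical
  rw [MvPowerSeries.WithPiTopology.hasSum_iff_hasSum_coeff]
  intro d
  have h : HasSum (fun x => coeff d (monomial (m x) (1 : R)))
      (∑ x ∈ (hm d).toFinset, coeff d (monomial (m x) (1 : R))) := by
    refine hasSum_sum_of_ne_finset_zero fun x hx => ?_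
    rw [coeff_monomial, if_neg]
    simpa [eq_comm] using hx
  convert h using 1
  rw [coeff_countingSeries, Set.ncard_eq_toFinset_card _ (hm d), Finset.sum_congr rfl fun x hx => ?_]
  · rw [Finset.sum_const, nsmul_one]
  · rw [coeff_monomial, if_pos]
    simpa [eq_comm] using hx

/-- At `d`, tuples are sorted by the exponents of their components, which range over the finitely
many ways to write `d` as a sum. -/
theorem prod_countingSeries {κ : Type*} [Fintype κ] {ι : κ → Type*} {m : ∀ i, ι i → E →₀ ℕ}
    (hm : ∀ i d, {x | m i x = d}.Finite) :
    ∏ i, countingSeries R (m i) = countingSeries R fun x : ∀ i, ι i => ∑ i, m i (x i) := by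
  classical
  ext d
  rw [coeff_prod, coeff_countingSeries]
  have key : {x : ∀ i, ι i | ∑ i, m i (x i) = d} =
      ((Finset.finsuppAntidiag Finset.univ d).biUnion fun l =>
        Fintype.piFinset fun i => (hm i (l i)).toFinset : Finset (∀ i, ι i)) := by
    ext x
    simp only [Set.mem_ofPred_eq, Finset.coe_biUnion, Set.mem_iUnion, Finset.mem_coe,
      Fintype.mem_piFinset, Set.Finite.mem_toFinset, Finset.mem_finsuppAntidiag, exists_prop]
    constructor
    · intro h
      exact ⟨Finsupp.equivFunOnFinite.symm fun i => m i (x i), by simpa using h, by simp⟩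
    · rintro ⟨l, ⟨hl, -⟩, hx⟩
      rw [← hl]
      exact Finset.sum_congr rfl fun i _ => hx i
  rw [key, Set.ncard_coe_finset, Finset.card_biUnion, Nat.cast_sum]
  · refine Finset.sum_congr rfl fun l _ => ?_
    rw [Fintype.card_piFinset, Nat.cast_prod]
    exact Finset.prod_congr rfl fun i _ => by
      rw [coeff_countingSeries, Set.ncard_eq_toFinset_card _ (hm i _)]
  · intro l _ l' _ hne
    rw [Function.onFun, Finset.disjoint_left]
    intro x hx hx'
    simp only [Fintype.mem_piFinset, Set.Finite.mem_toFinset, Set.mem_ofPred_eq] at hx hx'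
    exact hne (Finsupp.ext fun i => (hx i).symm.trans (hx' i))

theorem finite_setOf_coe_list_eq (s : Multiset E) : {l : List E | (l : Multiset E) = s}.Finite := by
  induction s using Quotient.inductionOn with
  | h q =>
    refine (List.finite_toSet q.permutations).subset fun l hl => ?_
    exact List.mem_permutations.2 (Multiset.coe_eq_coe.1 hl)

/-- Each component is an ordering of one of the finitely many submultisets of `s`. -/
theorem finite_setOf_sum_coe_list_eq {κ : Type*} [Fintype κ] (s : Multiset E) :
    {p : κ → List E | ∑ i, (p i : Multiset E) = s}.Finite := by
  classical
  have h : (⋃ t ∈ s.powerset.toFinset, {l : List E | (l : Multiset E) = t}).Finite :=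
    s.powerset.toFinset.finite_toSet.biUnion fun t _ => finite_setOf_coe_list_eq t
  refine (Set.Finite.pi' fun _ : κ => h).subset fun p hp i => ?_
  simp only [Multiset.mem_toFinset, Multiset.mem_powerset, Set.mem_iUnion, exists_prop,
    Set.mem_ofPred_eq, exists_eq_right']
  rw [← (show _ = s from hp)]
  exact Finset.single_le_sum (f := fun i => (p i : Multiset E)) (fun _ _ => Multiset.zero_le _)
    (Finset.mem_univ i)

end CountingSeries

/-! ### Walk weights as monomials, and the two loop erasures -/

namespace DirectedNetwork

variable {V E : Type*} {Γ : DirectedNetwork V E} {bd : Set V}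

open Classical in
/-- The exponent of the monomial of an edge sequence. -/
noncomputable def exponent (p : List E) : E →₀ ℕ := Multiset.toFinsupp (p : Multiset E)

theorem sum_exponent_eq_iff {κ : Type*} [Fintype κ] (p : κ → List E) (d : E →₀ ℕ) :
    ∑ i, exponent (p i) = d ↔ ∑ i, (p i : Multiset E) = Finsupp.toMultiset d := by
  classical
  have h : ∑ i, exponent (p i) = Multiset.toFinsupp (∑ i, (p i : Multiset E)) := by
    rw [map_sum]
    refine Finset.sum_congr rfl fun i _ => ?_
    rw [exponent]
  rw [h]
  constructor
  · rintro rfl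
    simp
  · intro h
    simp [h]

theorem finite_setOf_sum_exponent_eq {κ : Type*} [Fintype κ] (d : E →₀ ℕ) :
    {p : κ → List E | ∑ i, exponent (p i) = d}.Finite := by
  simp_rw [sum_exponent_eq_iff]
  exact finite_setOf_sum_coe_list_eq _

theorem finite_setOf_exponent_eq (d : E →₀ ℕ) : {p : List E | exponent p = d}.Finite := by
  have h := (finite_setOf_sum_exponent_eq (κ := Unit) d).image fun p => p ()
  refine h.subset fun p hp => ⟨fun _ => p, by simpa using hp, rfl⟩

namespace Walk

theorem weight_eq_monomial (R : Type*) [CommRing R] {a b : V} (π : Γ.Walk a b) :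
    π.weight R = MvPowerSeries.monomial (exponent π.edges) 1 := by
  classical
  rw [weight]
  induction π.edges with
  | nil => simp [exponent]
  | cons e p ih =>
    rw [List.map_cons, List.prod_cons, ih, MvPowerSeries.X, MvPowerSeries.monomial_mul_monomial,
      one_mul]
    congr 1
    rw [exponent, exponent, ← Multiset.cons_coe, ← Multiset.singleton_add, map_add,
      Multiset.toFinsupp_singleton]

theorem prod_weight_eq_monomial (R : Type*) [CommRing R] {κ : Type*} [Fintype κ] {a b : κ → V}
    (π : ∀ i, Γ.Walk (a i) (b i)) :
    ∏ i, (π i).weight R = MvPowerSeries.monomial (∑ i, exponent (π i).edges) 1 := by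
  classical
  simp_rw [weight_eq_monomial]
  induction (Finset.univ : Finset κ) using Finset.induction_on with
  | empty => simp
  | insert i s hi ih =>
    rw [Finset.prod_insert hi, Finset.sum_insert hi, ih, MvPowerSeries.monomial_mul_monomial,
      one_mul]

theorem isHitting_iff {a b : V} (π : Γ.Walk a b) :
    π.IsHitting bd ↔ Γ.IsHit bd a π.edges b :=
  ⟨fun h => ⟨π.isWalk, h⟩, fun h => h.2⟩

/-- The appended last step adds only the endpoint, a boundary vertex. This links `EndLEFamily` to
`MeetsAt`. -/
theorem mem_endLE_vertices_iff {a b x : V} (π : Γ.Walk a b) (hb : b ∈ bd) (hx : x ∉ bd) :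
    x ∈ π.endLE.vertices ↔ x ∈ Γ.vertices a (Γ.loopErase a π.edges.dropLast) := by
  rw [vertices, endLE, vertices_append, ← List.dropLast_eq_take, List.mem_append,
    or_iff_left]
  intro h
  obtain ⟨u, hu⟩ := π.isWalk.exists_vertices_eq_concat
  rcases List.eq_nil_or_concat π.edges with hp | ⟨p, e, hp⟩
  · simp [hp] at h
  · rw [List.concat_eq_append] at hp
    rw [hp, vertices_append] at hu
    simp only [hp, List.length_append, List.length_cons, List.length_nil, zero_add,
      add_tsub_cancel_right, List.drop_left, List.map_cons, List.map_nil,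
      List.mem_singleton] at h
    have : Γ.tgt e = b := by simpa using (List.append_inj' hu rfl).2
    exact hx (h ▸ this ▸ hb)

/-- If the starting point differs from the endpoint, then both loop erasures of a hitting walk
agree. -/
theorem IsHitting.endLE_eq {a b : V} {π : Γ.Walk a b} (h : π.IsHitting bd) (hb : b ∈ bd)
    (hab : a ≠ b) : π.endLE = π.LE := by
  ext1
  obtain ⟨u, hu⟩ := π.isWalk.exists_vertices_eq_concat
  have hint := (π.isHitting_iff.1 h).dropLast_interior
  rcases List.eq_nil_or_concat π.edges with hp | ⟨p, e, hp⟩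
  · exact absurd hp h.1
  · rw [List.concat_eq_append] at hp
    rw [hp, vertices_append] at hu
    rw [hp, List.dropLast_concat] at hint
    have he : Γ.tgt e = b := by simpa using (List.append_inj' hu rfl).2
    have hmem : Γ.tgt e ∉ Γ.vertices a (Γ.loopErase a p) := by
      intro hmem
      rcases List.mem_cons.1 (Γ.vertices_loopErase_subset a p hmem) with h1 | h1
      · exact hab (h1.symm.trans he)
      · exact hint _ h1 (he ▸ hb)
    change Γ.loopErase a (π.edges.take (π.edges.length - 1)) ++ π.edges.drop (π.edges.length - 1) =
      Γ.loopErase a π.edges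
    rw [hp, (Γ.loopErase_concat a p e).1 hmem]
    simp

end Walk

/-! ### The determinant formula, coefficient by coefficient -/

section Determinant

variable {k : ℕ} {a : Fin k → V} {b : Fin k → bd}

theorem lefamily_eq_endLEFamily (hab : ∀ i j, a i ≠ b j) (σ : Equiv.Perm (Fin k)) :
    Γ.LEFamily bd a b σ = Γ.EndLEFamily bd a b σ := by
  ext π
  refine and_congr_right fun h => forall_congr' fun i => ?_
  rw [(h i).endLE_eq (b (σ i)).2 (hab _ _)]

theorem mem_endLEFamily_iff {σ : Equiv.Perm (Fin k)} {π : ∀ i, Γ.Walk (a i) (b (σ i))} :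
    π ∈ Γ.EndLEFamily bd a b σ ↔ (∀ i, Γ.IsHit bd (a i) (π i).edges (b (σ i))) ∧
      ¬ ∃ i, Γ.MeetsAt bd a (fun i => (π i).edges) i := by
  refine and_congr (forall_congr' fun i => (π i).isHitting_iff) ?_
  unfold MeetsAt
  push Not
  refine forall_congr' fun i => forall_congr' fun j => imp_congr_right fun _ =>
    forall_congr' fun v => imp_congr_right fun hv => imp_congr_right fun _ => not_congr ?_
  exact (π i).mem_endLE_vertices_iff (b (σ i)).2 hv

/-- Counting a type of families of walks with a given exponent through the edge sequences. -/
theorem ncard_setOf_sum_exponent_eq {κ : Type*} [Fintype κ] {ι : Type*}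
    {f : ι → κ → List E} (hf : Function.Injective f) {Q : (κ → List E) → Prop}
    [DecidablePred Q] (hQ : ∀ p, Q p ↔ p ∈ Set.range f) {d : E →₀ ℕ} {P : Finset (κ → List E)}
    (hP : ∀ p, p ∈ P ↔ ∑ i, exponent (p i) = d) :
    Set.ncard {x | ∑ i, exponent (f x i) = d} =
      (P.filter Q).card := by
  rw [← Set.ncard_image_of_injective _ hf, ← Set.ncard_coe_finset]
  congr 1
  ext p
  simp only [Set.mem_image, Set.mem_ofPred_eq, Finset.coe_filter, hP, hQ]
  constructor
  · rintro ⟨x, hx, rfl⟩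
    exact ⟨hx, x, rfl⟩
  · rintro ⟨h, x, rfl⟩
    exact ⟨x, h, rfl⟩

theorem finite_setOf_exponent_walk_eq (x y : V) (d : E →₀ ℕ) :
    {π : {π : Γ.Walk x y // π.IsHitting bd} | exponent π.1.edges = d}.Finite := by
  refine (finite_setOf_exponent_eq d).preimage
    (f := fun π : {π : Γ.Walk x y // π.IsHitting bd} => π.1.edges) ?_
  exact fun π _ π' _ h => Subtype.ext (Walk.ext h)

theorem injective_edges {σ : Equiv.Perm (Fin k)} :
    Function.Injective fun (π : ∀ i, Γ.Walk (a i) (b (σ i))) i => (π i).edges :=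
  fun _ _ h => funext fun i => Walk.ext (congrFun h i)

theorem finite_setOf_exponent_family_eq (σ : Equiv.Perm (Fin k)) (d : E →₀ ℕ) :
    {π : Γ.EndLEFamily bd a b σ | ∑ i, exponent (π.1 i).edges = d}.Finite := by
  refine (finite_setOf_sum_exponent_eq d).preimage
    (f := fun (π : Γ.EndLEFamily bd a b σ) i => (π.1 i).edges) ?_
  exact fun π _ π' _ h => Subtype.ext (injective_edges h)

variable (R : Type*) [CommRing R] [TopologicalSpace R]

theorem hasSum_weight (x y : V) :
    HasSum (fun π : {π : Γ.Walk x y // π.IsHitting bd} => π.1.weight R)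
      (countingSeries R fun π : {π : Γ.Walk x y // π.IsHitting bd} => exponent π.1.edges) := by
  simp_rw [Walk.weight_eq_monomial]
  exact hasSum_countingSeries R (finite_setOf_exponent_walk_eq x y)

theorem hasSum_prod_weight (σ : Equiv.Perm (Fin k)) :
    HasSum (fun π : Γ.EndLEFamily bd a b σ => ∏ i, (π.1 i).weight R)
      (countingSeries R fun π : Γ.EndLEFamily bd a b σ => ∑ i, exponent (π.1 i).edges) := by
  simp_rw [Walk.prod_weight_eq_monomial]
  exact hasSum_countingSeries R (finite_setOf_exponent_family_eq σ)

/-- At each exponent `d` both sides are signed counts of edge-sequence families: all admissible ones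
on the left, those without intersection (`¬ B`) on the right. The difference is the signed count
over `B`, which vanishes. -/
theorem det_hittingMatrix [T2Space R] :
    ((Γ.hittingMatrix R bd).submatrix a b).det =
      ∑ σ : Equiv.Perm (Fin k), Equiv.Perm.sign σ •
        ∑' π : Γ.EndLEFamily bd a b σ, ∏ i, (π.1 i).weight R := by
  classical
  have hentry (i j) : (Γ.hittingMatrix R bd).submatrix a b i j = countingSeries R
      fun π : {π : Γ.Walk (a i) (b j) // π.IsHitting bd} => exponent π.1.edges :=
    (hasSum_weight R _ _).tsum_eq
  -- `Matrix.det_apply` has `σ` on the row index; transposing moves it to the column, so that walks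
  -- run from `a i` to `b (σ i)`.
  rw [← Matrix.det_transpose, Matrix.det_apply]
  simp_rw [Matrix.transpose_apply, hentry, (hasSum_prod_weight R _).tsum_eq]
  have hprod (σ : Equiv.Perm (Fin k)) := prod_countingSeries R
    fun i => finite_setOf_exponent_walk_eq (Γ := Γ) (bd := bd) (a i) (b (σ i))
  simp_rw [hprod]
  ext d
  obtain ⟨P, hP⟩ : ∃ P : Finset (Fin k → List E), ∀ p, p ∈ P ↔ ∑ i, exponent (p i) = d :=
    ⟨(finite_setOf_sum_exponent_eq d).toFinset, fun p => by simp⟩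
  obtain ⟨A, hA⟩ : ∃ A : Equiv.Perm (Fin k) → (Fin k → List E) → Prop,
      ∀ σ p, A σ p ↔ ∀ i, Γ.IsHit bd (a i) (p i) (b (σ i)) := ⟨_, fun _ _ => Iff.rfl⟩
  obtain ⟨B, hB⟩ : ∃ B : (Fin k → List E) → Prop, ∀ p, B p ↔ ∃ i, Γ.MeetsAt bd a p i :=
    ⟨_, fun _ => Iff.rfl⟩
  have hall (σ : Equiv.Perm (Fin k)) :
      Set.ncard {x : ∀ i, {π : Γ.Walk (a i) (b (σ i)) // π.IsHitting bd} |
        ∑ i, exponent (x i).1.edges = d} = (P.filter (A σ)).card := by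
    refine ncard_setOf_sum_exponent_eq
      (f := fun (x : ∀ i, {π : Γ.Walk (a i) (b (σ i)) // π.IsHitting bd}) i => (x i).1.edges)
      ?_ ?_ hP
    · exact fun x y h => funext fun i => Subtype.ext (Walk.ext (congrFun h i))
    · intro p
      rw [hA]
      constructor
      · exact fun h => ⟨fun i => ⟨⟨p i, (h i).1⟩, (h i).2⟩, rfl⟩
      · rintro ⟨x, rfl⟩ i
        exact (x i).1.isHitting_iff.1 (x i).2
  have hgood (σ : Equiv.Perm (Fin k)) :
      Set.ncard {π : Γ.EndLEFamily bd a b σ | ∑ i, exponent (π.1 i).edges = d} =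
        (P.filter fun p => A σ p ∧ ¬ B p).card := by
    refine ncard_setOf_sum_exponent_eq
      (f := fun (π : Γ.EndLEFamily bd a b σ) i => (π.1 i).edges) ?_ ?_ hP
    · exact fun x y h => Subtype.ext (injective_edges h)
    · intro p
      rw [hA, hB]
      constructor
      · exact fun h => ⟨⟨fun i => ⟨p i, (h.1 i).1⟩, mem_endLEFamily_iff.2 h⟩, rfl⟩
      · rintro ⟨π, rfl⟩
        exact mem_endLEFamily_iff.1 π.2
  have hsplit (σ : Equiv.Perm (Fin k)) : (P.filter (A σ)).card =
      (P.filter fun p => A σ p ∧ B p).card + (P.filter fun p => A σ p ∧ ¬ B p).card := by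
    rw [← Finset.filter_filter, ← Finset.filter_filter, Finset.card_filter_add_card_filter_not]
  have hbad : ∑ σ : Equiv.Perm (Fin k),
      (Equiv.Perm.sign σ : ℤ) * ((P.filter fun p => A σ p ∧ B p).card : ℤ) = 0 := by
    -- The cancellation needs all `σ` at once: it is applied to the pairs `(σ, p)` with edge
    -- multiset `d`, and the sum is then regrouped by `σ`.
    rw [← sum_sign_eq_zero (Γ := Γ) (bd := bd) (a := a) (b := fun i => (b i : V))
      (fun i => (b i).2) (Finsupp.toMultiset d)
      ((Finset.univ ×ˢ P).filter fun t => A t.1 t.2 ∧ B t.2) fun t => ?_]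
    · rw [Finset.sum_filter, Finset.sum_product]
      refine Finset.sum_congr rfl fun σ _ => ?_
      rw [← Finset.sum_filter]
      dsimp only
      rw [Finset.sum_const, nsmul_eq_mul, mul_comm]
    · simp only [Finset.mem_filter, Finset.mem_product, Finset.mem_univ, true_and,
        hP, hA, hB, sum_exponent_eq_iff]
      tauto
  have hcoeff (N : Equiv.Perm (Fin k) → MvPowerSeries E R) :
      MvPowerSeries.coeff d (∑ σ, Equiv.Perm.sign σ • N σ) =
        ∑ σ, ((Equiv.Perm.sign σ : ℤ) : R) * MvPowerSeries.coeff d (N σ) := by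
    rw [map_sum]
    refine Finset.sum_congr rfl fun σ _ => ?_
    rw [Units.smul_def, map_zsmul, zsmul_eq_mul]
  rw [hcoeff, hcoeff]
  simp_rw [coeff_countingSeries, hall, hgood, hsplit, Nat.cast_add, mul_add,
    Finset.sum_add_distrib]
  have hbad' := congrArg (Int.cast : ℤ → R) hbad
  push_cast at hbad'
  rw [hbad', zero_add]

end Determinant

end DirectedNetwork

theorem mainTheorem3 {V E R : Type*} [CommRing R] [TopologicalSpace R] [T2Space R]
    (Γ : DirectedNetwork V E) (bd : Set V) {k : ℕ} (a : Fin k → V) (b : Fin k → bd)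
    (ha : Function.Injective a) (hb : Function.Injective b) :
    -- the power series that define the hitting matrix are well defined
    (∀ (x : V) (y : bd), Summable fun π : {π : Γ.Walk x y // π.IsHitting bd} => π.1.weight R) ∧
    -- the formula, for arbitrary `A` and `B`
    ((∀ σ : Equiv.Perm (Fin k),
        Summable fun π : Γ.EndLEFamily bd a b σ => ∏ i, (π.1 i).weight R) ∧
      ((Γ.hittingMatrix R bd).submatrix a b).det =
        ∑ σ : Equiv.Perm (Fin k), Equiv.Perm.sign σ •
          ∑' π : Γ.EndLEFamily bd a b σ, ∏ i, (π.1 i).weight R) ∧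
    -- the formula with the usual loop erasure, when `A` and `B` have no common element
    ((∀ i j, a i ≠ b j) →
      (∀ σ : Equiv.Perm (Fin k),
        Summable fun π : Γ.LEFamily bd a b σ => ∏ i, (π.1 i).weight R) ∧
      ((Γ.hittingMatrix R bd).submatrix a b).det =
        ∑ σ : Equiv.Perm (Fin k), Equiv.Perm.sign σ •
          ∑' π : Γ.LEFamily bd a b σ, ∏ i, (π.1 i).weight R) := by
  have h2 := fun σ : Equiv.Perm (Fin k) =>
    (DirectedNetwork.hasSum_prod_weight (Γ := Γ) (a := a) (b := b) R σ).summable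
  have h3 := DirectedNetwork.det_hittingMatrix (Γ := Γ) (a := a) (b := b) R
  refine ⟨fun x y => (DirectedNetwork.hasSum_weight R x y).summable, ⟨h2, h3⟩, fun hab => ?_⟩
  refine ⟨fun σ => ?_, h3.trans (Finset.sum_congr rfl fun σ _ => ?_)⟩
  · rw [DirectedNetwork.lefamily_eq_endLEFamily hab]
    exact h2 σ
  · rw [DirectedNetwork.lefamily_eq_endLEFamily hab]
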